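/- Consider a distributed control system with $n$ agents $\mathcal X=\{x_1,\dots,x_n\}$ and $m$ observers $\mathcal Y=\{y_1,\dots,y_m\}$. Its interactions are given by a directed graph $\mathcal G$ on $\mathcal V=\mathcal X\cup\mathcal Y$ whose edges run from agents to agents or from agents to observers, in which every agent has a self loop, every observer has exactly one incoming edge (it measures exactly one agent), and no two observers measure the same agent. Let $p$ be an integer with $0\le p\le m$. For a set $F\subseteq\mathcal V$ of attacked nodes, $p'=|F|$, let $\mathcal G^a$ be obtained from $\mathcal G$ by adding, for every $v\in F$, one attack input $u_v$ with a single edge $u_v\to v$; put $\mathcal U=\{u_v : v\in F\}$. Let $([A],[B^a],[C],[D^a])$ be the associated structural matrices, of sizes $n\times n$, $n\times p'$, $m\times n$, $m\times p'$: the entry of $[A]$, $[B^a]$, $[C]$, $[D^a]$ in the row of $b$ and the column of $a$ is a free real parameter if $(a,b)$ is an edge of $\mathcal G^a$ from $\mathcal X$ to $\mathcal X$, from $\mathcal U$ to $\mathcal X$, from $\mathcal X$ to $\mathcal Y$, from $\mathcal U$ to $\mathcal Y$ respectively, and it is fixed to be $0$ otherwise. A realization $(A,B^a,C,D^a)$ is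 left invertible if for the system $x(k+1)=Ax(k)+B^au(k)$, $y(k)=Cx(k)+D^au(k)$, $k=0,1,2,\dots$, with $x(0)=0$, the condition $y(k)=0$ for all $k$ implies $u(k)=0$ for all $k$. The structural system $([A],[B^a],[C],[D^a])$ is structurally left invertible if the set of values of the free parameters for which the realization is not left invertible has Lebesgue measure zero. Let $\mathcal G'$ be the directed graph on $\mathcal X\cup\mathcal Y\cup\{o\}$ obtained from $\mathcal G^a$ by removing the attack inputs (which gives back $\mathcal G$) and adding a node $o$ with an edge from every observer to $o$. A vertex separator of a pair $(a,b)$ of distinct vertices without an edge from $a$ to $b$ is a set of vertices, containing neither $a$ nor $b$, that meets every directed path from $a$ to $b$. Then the following are equivalent: 1. for every $F\subseteq\mathcal V$ with $|F|\le p$, the system $([A],[B^a],[C],[D^a])$ is structurally left invertible; 2. for every agent $x_i\in\mathcal X$, every vertex separator $S_i$ of $(x_i,o)$ in $\mathcal G'$ satisfies $|S_i|\ge p$. -/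

import Mathlib

open scoped Matrix

namespace DCS

/-! ### Linear systems and left invertibility -/

/-- The system `x(k+1) = A x(k) + B u(k)`, `y(k) = C x(k) + D u(k)` with `x(0) = 0` is left
invertible if `y(k) = 0` for all `k` implies `u(k) = 0` for all `k`. -/
def LeftInvertible {X U Y : Type*} [Fintype X] [Fintype U]
    (A : Matrix X X ℝ) (B : Matrix X U ℝ) (C : Matrix Y X ℝ) (D : Matrix Y U ℝ) : Prop :=
  ∀ (x : ℕ → X → ℝ) (u : ℕ → U → ℝ) (y : ℕ → Y → ℝ),
    x 0 = 0 →
    (∀ k, x (k + 1) = A *ᵥ x k + B *ᵥ u k) →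
    (∀ k, y k = C *ᵥ x k + D *ᵥ u k) →
    (∀ k, y k = 0) → ∀ k, u k = 0

/-- A tuple of structural matrices `([A], [B], [C], [D])`: for each matrix, the set of positions
(row, column) whose entry is a free real parameter. All other entries are fixed to be `0`. -/
structure StructuralSystem (X U Y : Type*) where
  freeA : Set (X × X)
  freeB : Set (X × U)
  freeC : Set (Y × X)
  freeD : Set (Y × U)

namespace StructuralSystem

variable {X U Y : Type*}

/-- The free entries of the four matrices together. -/
def FreeEntry (S : StructuralSystem X U Y) : Type _ :=
  S.freeA ⊕ S.freeB ⊕ S.freeC ⊕ S.freeD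

noncomputable instance [Finite X] [Finite U] [Finite Y] (S : StructuralSystem X U Y) :
    Fintype S.FreeEntry :=
  @Fintype.ofFinite _ (inferInstanceAs (Finite (S.freeA ⊕ S.freeB ⊕ S.freeC ⊕ S.freeD)))

open Classical in
/-- The matrix `A` of the admissible realization with parameter vector `θ`. -/
noncomputable def matA (S : StructuralSystem X U Y) (θ : S.FreeEntry → ℝ) : Matrix X X ℝ :=
  fun i j => if h : (i, j) ∈ S.freeA then θ (Sum.inl ⟨(i, j), h⟩) else 0

open Classical in
/-- The matrix `B` of the admissible realization with parameter vector `θ`. -/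
noncomputable def matB (S : StructuralSystem X U Y) (θ : S.FreeEntry → ℝ) : Matrix X U ℝ :=
  fun i j => if h : (i, j) ∈ S.freeB then θ (Sum.inr (Sum.inl ⟨(i, j), h⟩)) else 0

open Classical in
/-- The matrix `C` of the admissible realization with parameter vector `θ`. -/
noncomputable def matC (S : StructuralSystem X U Y) (θ : S.FreeEntry → ℝ) : Matrix Y X ℝ :=
  fun i j => if h : (i, j) ∈ S.freeC then θ (Sum.inr (Sum.inr (Sum.inl ⟨(i, j), h⟩))) else 0

open Classical in
/-- The matrix `D` of the admissible realization with parameter vector `θ`. -/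
noncomputable def matD (S : StructuralSystem X U Y) (θ : S.FreeEntry → ℝ) : Matrix Y U ℝ :=
  fun i j => if h : (i, j) ∈ S.freeD then θ (Sum.inr (Sum.inr (Sum.inr ⟨(i, j), h⟩))) else 0

/-- All admissible realizations are left invertible, except for a set of Lebesgue measure zero
in the space of free parameters. -/
def StructurallyLeftInvertible [Fintype X] [Fintype U] [Fintype Y]
    (S : StructuralSystem X U Y) : Prop :=
  ∀ᵐ θ : S.FreeEntry → ℝ ∂MeasureTheory.volume,
    LeftInvertible (S.matA θ) (S.matB θ) (S.matC θ) (S.matD θ)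

end StructuralSystem

/-! ### Paths and vertex separators in directed graphs -/

/-- `P` is a path (repeated vertices allowed) from `a` to `b` in `G`. -/
def IsPathFromTo {V : Type*} (G : Digraph V) (a b : V) (P : List V) : Prop :=
  P.IsChain G.Adj ∧ P.head? = some a ∧ P.getLast? = some b

/-- `S` is a vertex separator of the nonadjacent vertices `(a, b)`: a set of vertices other than
`a` and `b` that meets every path from `a` to `b`. -/
def IsVertexSeparator {V : Type*} (G : Digraph V) (a b : V) (S : Finset V) : Prop :=
  a ≠ b ∧ ¬ G.Adj a b ∧ a ∉ S ∧ b ∉ S ∧ ∀ P : List V, IsPathFromTo G a b P → ∃ v ∈ P, v ∈ S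

/-! ### Distributed control systems under attack -/

/-- The nodes: agents `x_i = Sum.inl i` and observers `y_k = Sum.inr k`. -/
abbrev Node (n m : ℕ) : Type := Fin n ⊕ Fin m

/-- The interaction graph of `n` agents and `m` dedicated observers. -/
structure Network (n m : ℕ) where
  /-- the directed graph on agents and observers -/
  graph : Digraph (Node n m)
  /-- edges only run between agents and from agents to observers -/
  observer_no_out : ∀ (k : Fin m) (v : Node n m), ¬ graph.Adj (Sum.inr k) v
  /-- every agent has a self loop -/
  self_loop : ∀ i : Fin n, graph.Adj (Sum.inl i) (Sum.inl i)
  /-- every observer measures exactly one agent -/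
  dedicated : ∀ k : Fin m, ∃! i : Fin n, graph.Adj (Sum.inl i) (Sum.inr k)
  /-- no two observers measure the same agent -/
  distinct : ∀ (i : Fin n) (k l : Fin m),
    graph.Adj (Sum.inl i) (Sum.inr k) → graph.Adj (Sum.inl i) (Sum.inr l) → k = l

/-- The feasible sets of attacked nodes: at most `p` agents and observers in total. -/
def feasibleAttacks (n m p : ℕ) : Set (Finset (Node n m)) :=
  {F | F.card ≤ p}

namespace Network

variable {n m : ℕ}

/-- The graph under the attack `F`: every attacked node `v ∈ F` gets its own attack input
`Sum.inr v`, with a single edge, to `v`. -/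
def attackGraph (N : Network n m) (F : Finset (Node n m)) : Digraph (Node n m ⊕ F) where
  Adj
    | Sum.inl v, Sum.inl w => N.graph.Adj v w
    | Sum.inr u, Sum.inl w => (u : Node n m) = w
    | _, Sum.inr _ => False

/-- The structural matrices `([A], [B^a], [C], [D^a])` of the graph under the attack `F`: the
entry in row `b` and column `a` is free exactly if there is an edge from `a` to `b`. -/
def attackedSystem (N : Network n m) (F : Finset (Node n m)) :
    StructuralSystem (Fin n) F (Fin m) where
  freeA := {e | (N.attackGraph F).Adj (Sum.inl (Sum.inl e.2)) (Sum.inl (Sum.inl e.1))}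
  freeB := {e | (N.attackGraph F).Adj (Sum.inr e.2) (Sum.inl (Sum.inl e.1))}
  freeC := {e | (N.attackGraph F).Adj (Sum.inl (Sum.inl e.2)) (Sum.inl (Sum.inr e.1))}
  freeD := {e | (N.attackGraph F).Adj (Sum.inr e.2) (Sum.inl (Sum.inr e.1))}

/-- The graph `G'` on agents, observers and a sink `o = none`: the attack inputs are removed
(which leaves the graph of the network, whatever the attack) and there is an edge from every
observer to the sink. -/
def sinkGraph (N : Network n m) : Digraph (Option (Node n m)) where
  Adj
    | some v, some w => N.graph.Adj v w
    | some (Sum.inr _), none => True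
    | some (Sum.inl _), none => False
    | none, _ => False

end Network

end DCS

/-! Both directions concern regions of the graph and their exits. If fewer than `p` vertices
separate `x_i` from `o`, an attack on them and on `x_i` excites `x_i` and cancels everything leaving
the enclosed region, so no output is seen, whatever the parameters (`not_leftInvertible_of_region`).
Conversely, left invertibility follows from a nonzero maximal minor of the Rosenbrock matrix at `1`.
Such a minor is analytic in the parameters, so one good parameter vector suffices, and a matching of
columns with rows along edges provides it. Self loops make the diagonal of `1 - A` adjustable. If no
matching exists, a violation of Hall's condition yields a separator with fewer than `|F|` vertices
(`exists_matching`). -/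

open MeasureTheory Filter

/-! ### Zero sets of analytic functions -/

/-- A real analytic function on a finite-dimensional space that does not vanish identically is
nonzero almost everywhere. -/
theorem AnalyticOnNhd.ae_ne_zero {E : Type*} [NormedAddCommGroup E] [NormedSpace ℝ E]
    [FiniteDimensional ℝ E] [MeasurableSpace E] [BorelSpace E] (μ : Measure E)
    [μ.IsAddHaarMeasure] {f : E → ℝ} (hf : AnalyticOnNhd ℝ f Set.univ) {a : E} (ha : f a ≠ 0) :
    ∀ᵐ x ∂μ, f x ≠ 0 := by
  have hcont : Continuous f := continuous_iff_continuousAt.2 fun x => (hf x trivial).continuousAt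
  -- every line through `a` meets the zero set in a null set
  have hline : ∀ v : E, ∀ᵐ t : ℝ, f (a + t • v) ≠ 0 := by
    intro v
    have hg : AnalyticOnNhd ℝ (fun t : ℝ => f (a + t • v)) Set.univ := by
      intro t _
      exact AnalyticAt.fun_comp (g := f) (f := fun t : ℝ => a + t • v) (hf _ trivial) (by fun_prop)
    have h := hg.preimage_zero_mem_codiscrete (x := 0) (by simpa using ha)
    have h' := ae_restrict_le_codiscreteWithin (μ := (volume : Measure ℝ)) MeasurableSet.univ h
    rw [Measure.restrict_univ] at h'
    filter_upwards [h'] with t ht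
    simpa using ht
  have hmeas : MeasurableSet {q : ℝ × E | f (a + q.1 • q.2) = 0} :=
    (isClosed_eq (by fun_prop) continuous_const).measurableSet
  -- Fubini turns "every direction, almost every `t`" into "almost every `t`, almost every
  -- direction". One such `t ≠ 0` is enough, since `v ↦ a + t • v` preserves null sets.
  have hae : ∀ᵐ t : ℝ, ∀ᵐ v ∂μ, f (a + t • v) ≠ 0 := by
    refine (Measure.ae_ae_comm ?_).1 (Eventually.of_forall hline)
    exact (measurable_swap hmeas).compl
  obtain ⟨t, ht, ht0⟩ := (hae.and (Measure.ae_ne volume (0 : ℝ))).exists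
  have hpre : μ ((t • ·) ⁻¹' {w : E | f (a + w) = 0}) = 0 := by
    simpa [ae_iff] using ht
  rw [Measure.addHaar_preimage_smul μ ht0] at hpre
  have hz : μ {w : E | f (a + w) = 0} = 0 := by
    refine (mul_eq_zero.1 hpre).resolve_left ?_
    simp [ht0]
  have := measure_preimage_add μ a {x | f x = 0}
  rw [ae_iff]
  simpa using this.symm.trans hz

/-- The determinant of a matrix of analytic functions is analytic. -/
theorem AnalyticOnNhd.matrix_det {E ι : Type*} [NormedAddCommGroup E] [NormedSpace ℝ E]
    [Fintype ι] [DecidableEq ι] {M : E → Matrix ι ι ℝ} {s : Set E}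
    (hM : ∀ i j, AnalyticOnNhd ℝ (fun x => M x i j) s) :
    AnalyticOnNhd ℝ (fun x => (M x).det) s := by
  simp only [Matrix.det_apply']
  refine Finset.analyticOnNhd_fun_sum _ fun σ _ => analyticOnNhd_const.mul ?_
  exact Finset.analyticOnNhd_fun_prod _ fun i _ => hM _ _

/-! ### The Rosenbrock matrix -/

namespace DCS

/-- A system is left invertible as soon as its Rosenbrock matrix at the point `1` has a nonzero
minor of full column size. -/
theorem leftInvertible_of_det_ne_zero {X U Y : Type*} [Fintype X] [Fintype U]
    [DecidableEq X] [DecidableEq U]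
    (A : Matrix X X ℝ) (B : Matrix X U ℝ) (C : Matrix Y X ℝ) (D : Matrix Y U ℝ)
    (f : X ⊕ U → X ⊕ Y)
    (hdet : ((Matrix.fromBlocks (1 - A) (-B) C D).submatrix f id).det ≠ 0) :
    LeftInvertible A B C D := by
  intro x u y hx0 hx hy hy0
  -- The variable is the unit delay: since `x 0 = 0`, the generating series of state and input are
  -- annihilated by `P`. A minor nonzero at `1` is a nonzero polynomial, hence a nonzero power
  -- series.
  let P : Matrix (X ⊕ Y) (X ⊕ U) (Polynomial ℝ) := Matrix.fromBlocks
    (1 - (Polynomial.X : Polynomial ℝ) • A.map Polynomial.C)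
    (-((Polynomial.X : Polynomial ℝ) • B.map Polynomial.C))
    (C.map Polynomial.C) (D.map Polynomial.C)
  let ev : Polynomial ℝ →+* ℝ := Polynomial.evalRingHom 1
  let ps : Polynomial ℝ →+* PowerSeries ℝ := Polynomial.coeToPowerSeries.ringHom
  have hev : ev.mapMatrix (P.submatrix f id) =
      (Matrix.fromBlocks (1 - A) (-B) C D).submatrix f id := by
    ext i j
    rcases h : f i with r | r <;> rcases j with j | j <;>
      simp [P, ev, h, Matrix.one_apply, apply_ite (Polynomial.eval (1 : ℝ))]
  have hP : (P.submatrix f id).det ≠ 0 := by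
    intro h
    apply hdet
    rw [← hev, ← RingHom.map_det, h, map_zero]
  have hps : (ps.mapMatrix (P.submatrix f id)).det ≠ 0 := by
    rw [← RingHom.map_det]
    intro h
    exact hP (Polynomial.coe_injective ℝ (by simpa [ps] using h))
  let v : X ⊕ U → PowerSeries ℝ :=
    Sum.elim (fun i => PowerSeries.mk fun k => x k i) (fun i => PowerSeries.mk fun k => u k i)
  have hfull : P.map ps *ᵥ v = 0 := by
    ext r k
    rcases r with r | r
    · rcases k with _ | k
      · have := congrFun hx0 r
        simp [P, ps, v, Matrix.mulVec, dotProduct, Matrix.one_apply, sub_mul, mul_assoc,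
          Finset.sum_sub_distrib, apply_ite (fun q : Polynomial ℝ => (q : PowerSeries ℝ)), this]
      · have := congrFun (hx k) r
        simp [P, ps, v, Matrix.mulVec, dotProduct, Matrix.one_apply, sub_mul, mul_assoc,
          Finset.sum_sub_distrib, apply_ite (fun q : Polynomial ℝ => (q : PowerSeries ℝ)),
          PowerSeries.coeff_succ_X_mul, this]
    · have := congrFun ((hy k).symm.trans (hy0 k)) r
      simpa [P, ps, v, Matrix.mulVec, dotProduct] using this
  have hv : v = 0 := by
    refine Matrix.eq_zero_of_mulVec_eq_zero hps ?_
    ext1 c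
    exact congrFun hfull (f c)
  intro k
  ext i
  have := congrArg (PowerSeries.coeff k) (congrFun hv (Sum.inr i))
  simpa [v] using this

end DCS
-- Separators and undetectable attacks
namespace DCS

/-- A set of vertices meets every path from `a` to `b` if and only if there is a region containing
`a` but not `b` that can only be left through the set. -/
theorem forall_path_meets_iff_exists_region {V : Type*} {G : Digraph V} {a b : V} {S : Finset V}
    (haS : a ∉ S) :
    (∀ P : List V, IsPathFromTo G a b P → ∃ v ∈ P, v ∈ S) ↔
      ∃ R : Set V, a ∈ R ∧ b ∉ R ∧ ∀ v ∈ R, ∀ w, G.Adj v w → w ∈ R ∨ w ∈ S := by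
  constructor
  · intro h
    refine ⟨{v | Relation.ReflTransGen (fun v w => G.Adj v w ∧ w ∉ S) a v}, .refl, ?_, ?_⟩
    · intro hb
      obtain ⟨l, hl, hlast⟩ := List.exists_isChain_cons_of_relationReflTransGen hb
      obtain ⟨v, hv, hvS⟩ := h (a :: l) ⟨hl.imp fun _ _ h => h.1, rfl, by
        rw [List.getLast?_eq_getLast_of_ne_nil (by simp), hlast]⟩
      have : ∀ (l : List V) (a : V), a ∉ S →
          (a :: l).IsChain (fun v w => G.Adj v w ∧ w ∉ S) → ∀ v ∈ a :: l, v ∉ S := by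
        intro l
        induction l with
        | nil => simp
        | cons c l ih =>
          intro a ha hc v hv
          rw [List.isChain_cons_cons] at hc
          rcases List.mem_cons.1 hv with rfl | hv
          · exact ha
          · exact ih c hc.1.2 hc.2 v hv
      exact this l a haS hl v hv hvS
    · intro v hv w hvw
      by_cases hw : w ∈ S
      · exact .inr hw
      · exact .inl (Relation.ReflTransGen.tail hv ⟨hvw, hw⟩)
  · rintro ⟨R, haR, hbR, hR⟩ P ⟨hchain, hhead, hlast⟩
    -- The induction restarts at vertices of `R` that may themselves lie in `S`.
    clear haS
    induction P generalizing a with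
    | nil => simp at hhead
    | cons c l ih =>
      obtain rfl : c = a := by simpa using hhead
      cases l with
      | nil =>
        obtain rfl : c = b := by simpa using hlast
        exact absurd haR hbR
      | cons d l =>
        rw [List.isChain_cons_cons] at hchain
        rcases hR c haR d hchain.1 with hd | hd
        · obtain ⟨v, hv, hvS⟩ := ih hd hchain.2 rfl (by simpa using hlast)
          exact ⟨v, List.mem_cons_of_mem _ hv, hvS⟩
        · exact ⟨d, by simp, hd⟩

namespace Network

variable {n m : ℕ} (N : Network n m) (F : Finset (Node n m))

/-- If the attacked nodes contain an agent `x_i` together with the boundary of a region of agents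
around `x_i`, then no realization is left invertible: the attacker excites `x_i` and cancels
whatever leaves the region. -/
theorem not_leftInvertible_of_region {F : Finset (Node n m)} {i : Fin n} {Q : Set (Node n m)}
    (hiF : Sum.inl i ∈ F) (hiQ : Sum.inl i ∈ Q) (hobs : ∀ k, Sum.inr k ∉ Q)
    (hQ : ∀ v ∈ Q, ∀ w, N.graph.Adj v w → w ∈ Q ∨ w ∈ F)
    (θ : (N.attackedSystem F).FreeEntry → ℝ) :
    ¬ LeftInvertible ((N.attackedSystem F).matA θ) ((N.attackedSystem F).matB θ)
      ((N.attackedSystem F).matC θ) ((N.attackedSystem F).matD θ) := by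
  classical
  intro hinv
  set A := (N.attackedSystem F).matA θ
  set B := (N.attackedSystem F).matB θ
  set C := (N.attackedSystem F).matC θ
  set D := (N.attackedSystem F).matD θ
  have hA0 : ∀ j j', ¬ N.graph.Adj (Sum.inl j') (Sum.inl j) → A j j' = 0 :=
    fun j j' h => dif_neg h
  have hC0 : ∀ k j, ¬ N.graph.Adj (Sum.inl j) (Sum.inr k) → C k j = 0 :=
    fun k j h => dif_neg h
  have hB0 : ∀ j (v : F), (v : Node n m) ≠ Sum.inl j → B j v = 0 := fun j v h => dif_neg h
  have hD0 : ∀ k (v : F), (v : Node n m) ≠ Sum.inr k → D k v = 0 := fun k v h => dif_neg h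
  -- Next state and output are treated as one vector indexed by nodes: `K` is the contribution of
  -- the state, `H` that of the attack.
  let K : (Fin n → ℝ) → Node n m → ℝ := fun z => Sum.elim (A *ᵥ z) (C *ᵥ z)
  let H : (F → ℝ) → Node n m → ℝ := fun z => Sum.elim (B *ᵥ z) (D *ᵥ z)
  let g : F → ℝ := fun v => Sum.elim (fun j => B j v) (fun k => D k v) (v : Node n m)
  have hH_mem : ∀ z (v : F), H z v = g v * z v := by
    rintro z ⟨j | k, hv⟩
    · refine Finset.sum_eq_single _ (fun w _ hw => ?_) (by simp)
      exact mul_eq_zero_of_left (hB0 j w fun h => hw (Subtype.ext h)) _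
    · refine Finset.sum_eq_single _ (fun w _ hw => ?_) (by simp)
      exact mul_eq_zero_of_left (hD0 k w fun h => hw (Subtype.ext h)) _
  have hH_notMem : ∀ z v, v ∉ F → H z v = 0 := by
    rintro z (j | k) hv
    · exact Finset.sum_eq_zero fun w _ =>
        mul_eq_zero_of_left (hB0 j w fun h => hv (h ▸ w.2)) _
    · exact Finset.sum_eq_zero fun w _ =>
        mul_eq_zero_of_left (hD0 k w fun h => hv (h ▸ w.2)) _
  have hinv' : ∀ (x : ℕ → Fin n → ℝ) (u : ℕ → F → ℝ), x 0 = 0 →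
      (∀ k v, K (x k) v + H (u k) v = Sum.elim (x (k + 1)) 0 v) → ∀ k, u k = 0 := by
    intro x u hx0 h
    refine hinv x u 0 hx0 (fun k => ?_) (fun k => ?_) fun _ => rfl
    · ext j
      exact (h k (Sum.inl j)).symm
    · ext l
      exact (h k (Sum.inr l)).symm
  -- An input with zero gain could be switched on without any effect.
  have hg : ∀ v, g v ≠ 0 := by
    intro v hv
    have := hinv' 0 (fun _ => Pi.single v 1) rfl (fun k w => by
      have h1 : K ((0 : ℕ → Fin n → ℝ) k) w = 0 := by rcases w with w | w <;> simp [K]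
      have h2 : Sum.elim ((0 : ℕ → Fin n → ℝ) (k + 1)) (0 : Fin m → ℝ) w = 0 := by
        rcases w with w | w <;> rfl
      rw [h1, h2, zero_add]
      by_cases hw : w ∈ F
      · rw [hH_mem _ ⟨w, hw⟩]
        by_cases hvw : (⟨w, hw⟩ : F) = v
        · rw [hvw, hv, zero_mul]
        · rw [Pi.single_eq_of_ne hvw, mul_zero]
      · exact hH_notMem _ _ hw) 0
    simpa using congrFun this v
  -- The intended trajectory: unforced dynamics inside `Q`, zero outside, and a unit pulse at `x_i`
  -- in the first step.
  let x : ℕ → Fin n → ℝ := fun k => Nat.rec 0 (fun k z j =>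
    if Sum.inl j ∈ Q then (A *ᵥ z) j + (if k = 0 ∧ j = i then 1 else 0) else 0) k
  have hxs : ∀ k j, x (k + 1) j =
      if Sum.inl j ∈ Q then (A *ᵥ x k) j + (if k = 0 ∧ j = i then 1 else 0) else 0 :=
    fun k j => rfl
  have hxQ : ∀ k j, Sum.inl j ∉ Q → x k j = 0 := by
    rintro (_ | k) j hj
    · rfl
    · rw [hxs, if_neg hj]
  have hK : ∀ k v, v ∉ Q → v ∉ F → K (x k) v = 0 := by
    rintro k (j | l) hvQ hvF
    · simp only [K, Sum.elim_inl, Matrix.mulVec, dotProduct]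
      refine Finset.sum_eq_zero fun j' _ => ?_
      by_cases hj' : Sum.inl j' ∈ Q
      · rw [hA0 _ _ fun h => (hQ _ hj' _ h).elim hvQ hvF, zero_mul]
      · rw [hxQ k j' hj', mul_zero]
    · simp only [K, Sum.elim_inr, Matrix.mulVec, dotProduct]
      refine Finset.sum_eq_zero fun j' _ => ?_
      by_cases hj' : Sum.inl j' ∈ Q
      · rw [hC0 _ _ fun h => (hQ _ hj' _ h).elim hvQ hvF, zero_mul]
      · rw [hxQ k j' hj', mul_zero]
  -- The input that enforces this trajectory and zero output at each attacked node; the other nodes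
  -- need no correction. The pulse makes it nonzero at time `0`.
  let u : ℕ → F → ℝ := fun k v => (Sum.elim (x (k + 1)) 0 (v : Node n m) - K (x k) v) / g v
  have hu := hinv' x u rfl (fun k v => by
    by_cases hv : v ∈ F
    · rw [hH_mem _ ⟨v, hv⟩, mul_div_cancel₀ _ (hg _), add_sub_cancel]
    · rw [hH_notMem _ _ hv, add_zero]
      rcases v with j | l
      · by_cases hj : Sum.inl j ∈ Q
        · have hji : j ≠ i := fun h => hv (h ▸ hiF)
          simp [K, hxs, hj, hji]
        · rw [hK k _ hj hv, Sum.elim_inl, hxQ (k + 1) j hj]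
      · rw [hK k _ (hobs l) hv]
        rfl) 0
  have hi := congrFun hu ⟨Sum.inl i, hiF⟩
  have hx0 : A *ᵥ x 0 = 0 := Matrix.mulVec_zero A
  simp [u, K, hxs, hiQ, hx0, hg] at hi

/-! ### Matchings and generic invertibility -/

/-- The nodes whose row may be matched with a column of the Rosenbrock matrix: an agent with its
out-neighbours, an attack input with the attacked node. -/
noncomputable def columnSupport : Fin n ⊕ F → Finset (Node n m) :=
  open Classical in
  Sum.elim (fun j => Finset.univ.filter fun w => N.graph.Adj (Sum.inl j) w) fun v => {(v : Node n m)}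

/-- If the columns of the Rosenbrock matrix can be matched with distinct rows along free entries,
then the system is structurally left invertible. -/
theorem structurallyLeftInvertible_of_matching {F : Finset (Node n m)} {f : Fin n ⊕ F → Node n m}
    (hf : Function.Injective f) (hfs : ∀ c, f c ∈ N.columnSupport F c) :
    (N.attackedSystem F).StructurallyLeftInvertible := by
  classical
  set T := N.attackedSystem F
  let M : (T.FreeEntry → ℝ) → Matrix (Node n m) (Fin n ⊕ F) ℝ := fun θ =>
    Matrix.fromBlocks (1 - T.matA θ) (-T.matB θ) (T.matC θ) (T.matD θ)
  have hanalytic : AnalyticOnNhd ℝ (fun θ => ((M θ).submatrix f id).det) Set.univ := by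
    refine AnalyticOnNhd.matrix_det fun c c' => ?_
    have hcoord : ∀ e : T.FreeEntry,
        AnalyticOnNhd ℝ (fun θ : T.FreeEntry → ℝ => θ e) Set.univ := fun e =>
      (ContinuousLinearMap.proj (R := ℝ) (φ := fun _ : T.FreeEntry => ℝ) e).analyticOnNhd _
    simp only [Matrix.submatrix_apply, id]
    rcases f c with r | r <;> rcases c' with c' | c'
    · refine AnalyticOnNhd.sub analyticOnNhd_const ?_
      simp only [StructuralSystem.matA]
      split_ifs
      exacts [hcoord _, analyticOnNhd_const]
    · refine AnalyticOnNhd.neg ?_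
      simp only [StructuralSystem.matB]
      split_ifs
      exacts [hcoord _, analyticOnNhd_const]
    · simp only [M, Matrix.fromBlocks_apply₂₁, StructuralSystem.matC]
      split_ifs
      exacts [hcoord _, analyticOnNhd_const]
    · simp only [M, Matrix.fromBlocks_apply₂₂, StructuralSystem.matD]
      split_ifs
      exacts [hcoord _, analyticOnNhd_const]
  -- Chosen so that the nonzero entries of `M θ₀` are exactly the matched ones. An unmatched self
  -- loop gets `1` to cancel the identity; a matched one gets `0`.
  let θ₀ : T.FreeEntry → ℝ := Sum.elim
    (fun e => if e.1.1 = e.1.2 ↔ Sum.inl e.1.1 = f (Sum.inl e.1.2) then 0 else 1)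
    (Sum.elim (fun _ => 1)
      (Sum.elim (fun e => if Sum.inr e.1.1 = f (Sum.inl e.1.2) then 1 else 0) fun _ => 1))
  have hadj : ∀ j, N.graph.Adj (Sum.inl j) (f (Sum.inl j)) := fun j => by
    simpa [columnSupport] using hfs (Sum.inl j)
  have hinput : ∀ v : F, f (Sum.inr v) = v := fun v => by
    simpa [columnSupport] using hfs (Sum.inr v)
  have hM : ∀ r c, M θ₀ r c ≠ 0 ↔ r = f c := by
    rintro (r | r) (c | c)
    · have hentry : T.matA θ₀ r c =
          if N.graph.Adj (Sum.inl c) (Sum.inl r) then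
            if r = c ↔ Sum.inl r = f (Sum.inl c) then (0 : ℝ) else 1 else 0 := by
        simp only [StructuralSystem.matA, θ₀, Sum.elim_inl]
        rfl
      simp only [M, Matrix.fromBlocks_apply₁₁, Matrix.sub_apply, hentry, Matrix.one_apply]
      by_cases h : Sum.inl r = f (Sum.inl c)
      · have := hadj c
        rw [← h] at this
        by_cases hrc : r = c
        · subst hrc
          simp [← h]
        · simp [← h, hrc, this]
      · by_cases hrc : r = c
        · subst hrc
          simp [h, N.self_loop r]
        · simp [h, hrc]
    · have hentry : T.matB θ₀ r c =
          if (c : Node n m) = Sum.inl r then (1 : ℝ) else 0 := by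
        simp only [StructuralSystem.matB, θ₀, Sum.elim_inl, Sum.elim_inr]
        rw [dite_eq_ite]
        exact if_congr Iff.rfl rfl rfl
      simp [M, hentry, hinput, eq_comm]
    · have hentry : T.matC θ₀ r c =
          if N.graph.Adj (Sum.inl c) (Sum.inr r) then
            if Sum.inr r = f (Sum.inl c) then (1 : ℝ) else 0 else 0 := by
        simp only [StructuralSystem.matC, θ₀, Sum.elim_inl, Sum.elim_inr]
        rfl
      by_cases h : Sum.inr r = f (Sum.inl c)
      · have := hadj c
        rw [← h] at this
        simp [M, hentry, this, ← h]
      · simp [M, hentry, h]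
    · have hentry : T.matD θ₀ r c =
          if (c : Node n m) = Sum.inr r then (1 : ℝ) else 0 := by
        simp only [StructuralSystem.matD, θ₀, Sum.elim_inr]
        rw [dite_eq_ite]
        exact if_congr Iff.rfl rfl rfl
      simp [M, hentry, hinput, eq_comm]
  have hdiag : (M θ₀).submatrix f id = Matrix.diagonal fun c => M θ₀ (f c) c := by
    ext c c'
    by_cases h : c = c'
    · subst h
      simp
    · rw [Matrix.diagonal_apply_ne _ h]
      exact not_not.1 fun h0 => h (hf ((hM _ _).1 h0))
  have hdet : ((M θ₀).submatrix f id).det ≠ 0 := by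
    rw [hdiag, Matrix.det_diagonal]
    exact Finset.prod_ne_zero_iff.2 fun c _ => (hM _ _).2 rfl
  filter_upwards [hanalytic.ae_ne_zero volume hdet] with θ hθ
  exact leftInvertible_of_det_ne_zero _ _ _ _ f hθ

/-- If every agent is separated from the sink only by sets of at least as many vertices as there
are attacked nodes, then the columns of the Rosenbrock matrix can be matched with rows. -/
theorem exists_matching {F : Finset (Node n m)}
    (h : ∀ (i : Fin n) (S : Finset (Option (Node n m))),
      IsVertexSeparator N.sinkGraph (some (Sum.inl i)) none S → F.card ≤ S.card) :
    ∃ f : Fin n ⊕ F → Node n m, Function.Injective f ∧ ∀ c, f c ∈ N.columnSupport F c := by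
  classical
  refine (Finset.all_card_le_biUnion_card_iff_exists_injective _).1 fun s => ?_
  by_contra! hlt
  set T := s.biUnion (N.columnSupport F)
  let J : Finset (Node n m) := s.toLeft.map Function.Embedding.inl
  let W : Finset (Node n m) := s.toRight.map (Function.Embedding.subtype _)
  have hTadj : ∀ j, Sum.inl j ∈ J → ∀ w, N.graph.Adj (Sum.inl j) w → w ∈ T := by
    intro j hj w hw
    refine Finset.mem_biUnion.2 ⟨Sum.inl j, by simpa [J] using hj, ?_⟩
    simpa [columnSupport] using hw
  have hJT : J ⊆ T := by
    intro v hv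
    obtain ⟨j, hj, rfl⟩ := Finset.mem_map.1 hv
    exact hTadj j hv _ (N.self_loop j)
  have hWT : W ⊆ T := by
    intro v hv
    obtain ⟨w, hw, rfl⟩ := Finset.mem_map.1 hv
    exact Finset.mem_biUnion.2 ⟨Sum.inr w, by simpa using hw, by simp [columnSupport]⟩
  have hWF : W ⊆ F := by
    intro v hv
    obtain ⟨w, hw, rfl⟩ := Finset.mem_map.1 hv
    exact w.2
  have hcard : T.card < J.card + W.card := by
    simpa [J, W, Finset.card_toLeft_add_card_toRight] using hlt
  -- The columns violating Hall's condition are the agents `J` and the inputs at `W`, with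
  -- neighbourhood `T`. The exits of `J` lie in `T \ J`; adding `F \ W` still leaves fewer than
  -- `|F|` vertices and forces any attacked node outside `S` into `J`.
  let S : Finset (Node n m) := (T \ J) ∪ (F \ W)
  have hS : S.card < F.card := by
    have h1 := Finset.card_union_le (T \ J) (F \ W)
    have h2 := Finset.card_sdiff_add_card_eq_card hJT
    have h3 := Finset.card_sdiff_add_card_eq_card hWF
    change ((T \ J) ∪ (F \ W)).card < _
    omega
  obtain ⟨v, hvF, hvS⟩ := Finset.exists_mem_notMem_of_card_lt_card hS
  have hvJ : v ∈ J := by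
    by_contra hvJ
    refine hvS ?_
    by_cases hvW : v ∈ W
    · exact Finset.mem_union_left _ (Finset.mem_sdiff.2 ⟨hWT hvW, hvJ⟩)
    · exact Finset.mem_union_right _ (Finset.mem_sdiff.2 ⟨hvF, hvW⟩)
  obtain ⟨i, -, rfl⟩ := Finset.mem_map.1 hvJ
  have hiS : some (Sum.inl i) ∉ S.map Function.Embedding.some := by simpa using hvS
  refine absurd (h i (S.map Function.Embedding.some) ⟨by simp, id, hiS, by simp, ?_⟩)
    (by simpa using hS)
  refine (forall_path_meets_iff_exists_region hiS).2
    ⟨{w | ∃ v ∈ J, some v = w}, ⟨_, hvJ, rfl⟩, by simp, ?_⟩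
  rintro _ ⟨v, hv, rfl⟩ w hvw
  obtain ⟨j, -, rfl⟩ := Finset.mem_map.1 hv
  rcases w with _ | w
  · exact hvw.elim
  · have hw : w ∈ T := hTadj j hv w hvw
    by_cases hwJ : w ∈ J
    · exact .inl ⟨w, hwJ, rfl⟩
    · exact .inr (by simpa [S] using .inl ⟨hw, hwJ⟩)

end Network

end DCS

theorem mainTheorem1 {n m : ℕ} (N : DCS.Network n m) (p : ℕ) (hpm : p ≤ m) :
    (∀ F ∈ DCS.feasibleAttacks n m p, (N.attackedSystem F).StructurallyLeftInvertible) ↔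
      ∀ (i : Fin n) (S : Finset (Option (DCS.Node n m))),
        DCS.IsVertexSeparator N.sinkGraph (some (Sum.inl i)) none S → p ≤ S.card := by
  classical
  constructor
  · rintro h i S ⟨-, -, hiS, hoS, hS⟩
    by_contra! hlt
    obtain ⟨R, hiR, hoR, hR⟩ := (DCS.forall_path_meets_iff_exists_region hiS).1 hS
    -- The strict inequality leaves room for attacking `x_i` as well.
    have hcard : (insert (Sum.inl i) S.eraseNone).card ≤ p := by
      have h1 := Finset.card_insert_le (Sum.inl i) S.eraseNone
      have h2 := Finset.card_eraseNone_le (s := S)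
      omega
    obtain ⟨θ, hθ⟩ := (h _ hcard).exists
    refine N.not_leftInvertible_of_region (Q := {v | some v ∈ R})
      (Finset.mem_insert_self _ _) hiR (fun k hk => ?_) (fun v hv w hvw => ?_) θ hθ
    -- An observer in `R` would have its edge to `o` as an illegal exit.
    · exact (hR _ hk none trivial).elim hoR hoS
    · exact (hR _ hv (some w) hvw).imp id fun hw =>
        Finset.mem_insert_of_mem (Finset.mem_eraseNone.2 hw)
  · intro h F hF
    obtain ⟨f, hf, hfs⟩ := N.exists_matching fun i S hS => hF.trans (h i S hS)
    exact N.structurallyLeftInvertible_of_matching hf hfs
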